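/- Let $n\ge 0$, let $A=(a_{ij})$ be an $n\times n$ integer matrix, and let $\varphi=\varphi_A$ be the monomial map of the torus $\mathbb{G}_m^n$, that is, $\varphi_A(x_1,\dots,x_n)=\bigl(\prod_j x_j^{a_{1j}},\dots,\prod_j x_j^{a_{nj}}\bigr)$. Let $M=\mathbb{Z}^n$ be the character lattice of $\mathbb{G}_m^n$, and write $P^{b}=\prod_j x_j^{b_j}$ for $b\in M$ and $P=(x_1,\dots,x_n)$. Let $S\subset M$ be a non-empty finite set whose differences $a-b$ $(a,b\in S)$ span $\mathbb{R}^n$ (for example $S=\{0,e_1,\dots,e_n\}$, which gives the usual embedding $\mathbb{G}_m^n\subset\mathbb{P}^n$, or the set of lattice points of the polytope of a very ample torus-invariant divisor on a projective toric variety of dimension $n$), and let $h(P)$ be the absolute logarithmic Weil height of the point $[P^{a}]_{a\in S}$ of projective space. With $h^+=\max\{h,1\}$, the arithmetic degree of $Q\in\mathbb{G}_m^n(\overline{\mathbb{Q}})$ is $$\alpha_\varphi(Q)=\lim_{k\to\infty}h^+(\varphi^k(Q))^{1/k}.$$ For a sublattice $L\subset M$ put $\mathbb{G}_L=\{P\in\mathbb{G}_m^n(\overline{\mathbb{Q}})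 : P^{a}=1 \text{ for all } a\in L\}$ and $\mathbb{G}_L^{\mathrm{div}}=\{P\in\mathbb{G}_m^n(\overline{\mathbb{Q}}) : P^k\in\mathbb{G}_L\text{ for some }k\ge 1\}$. Let $\mathfrak{L}$ be the set of sublattices $L\subset M$ that are saturated ($L=\mathrm{Span}_{\mathbb{R}}(L)\cap M$) and satisfy ${}^tA\,L\subset L$. For $L\in\mathfrak{L}$ let $r(L)$ be the spectral radius of the linear map $M/L\to M/L$ induced by ${}^tA$, that is, the largest absolute value of a complex eigenvalue (with $r(M)=0$). Proposition. The limit $\alpha_\varphi(Q)$ exists for every $Q\in\mathbb{G}_m^n(\overline{\mathbb{Q}})$, and the set of arithmetic degrees $\{\alpha_\varphi(Q) : Q\in\mathbb{G}_m^n(\overline{\mathbb{Q}})\}$ is finite with smallest element $1$. Write its elements as $1=\rho_0<\rho_1<\dots<\rho_s$. Then for every $j=0,\dots,s$, $$\{Q\in\mathbb{G}_m^n(\overline{\mathbb{Q}}) : \alpha_\varphi(Q)\le\rho_j\}=\bigcup_{L\in\mathfrak{L},\ r(L)\le\rho_j}\mathbb{G}_L^{\mathrm{div}}.$$ -/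

import Mathlib

namespace MonomialDynamics

noncomputable section

open Filter Topology

/-- The field of algebraic numbers. -/
abbrev Qbar : Type := AlgebraicClosure ℚ

instance qbar_isAlgebraic : Algebra.IsAlgebraic ℚ Qbar := by
  have h : (DivisionRing.toRatAlgebra : Algebra ℚ Qbar) = AlgebraicClosure.instAlgebra ℚ :=
    Subsingleton.elim _ _
  rw [h]
  exact AlgebraicClosure.isAlgebraic ℚ

/-- The algebraic points `𝔾ₘⁿ(ℚ̄)` of the `n`-dimensional torus, as a group. -/
abbrev Torus (n : ℕ) : Type := Fin n → Qbarˣ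

/-- The character lattice `M = ℤⁿ` of the torus. -/
abbrev CharLattice (n : ℕ) : Type := Fin n → ℤ

/-- The value `P ^ b = x₁ ^ b₁ ⋯ xₙ ^ bₙ` of the character `b` at the point `P`. -/
def character {n : ℕ} (b : CharLattice n) (P : Torus n) : Qbarˣ :=
  ∏ j, P j ^ b j

/-- The monomial map `φ_A`, whose `i`-th coordinate is `x₁ ^ a_{i1} ⋯ xₙ ^ a_{in}`. -/
def monomialMap {n : ℕ} (A : Matrix (Fin n) (Fin n) ℤ) (P : Torus n) : Torus n :=
  fun i => character (A i) P

/-! ### Heights and arithmetic degrees -/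

/-- The number field generated by the entries of a finite tuple of algebraic numbers. -/
abbrev coordField {ι : Type*} (x : ι → Qbar) : IntermediateField ℚ Qbar :=
  IntermediateField.adjoin ℚ (Set.range x)

instance coordField_numberField {ι : Type*} [Finite ι] (x : ι → Qbar) :
    NumberField (coordField x) where
  to_charZero := inferInstance
  to_finiteDimensional :=
    IntermediateField.finiteDimensional_adjoin fun y _ =>
      (Algebra.IsAlgebraic.isAlgebraic (R := ℚ) y).isIntegral

/-- A tuple of algebraic numbers, with its entries regarded in the field that they generate. -/
def toCoordField {ι : Type*} (x : ι → Qbar) : ι → coordField x :=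
  fun i => ⟨x i, IntermediateField.subset_adjoin ℚ _ (Set.mem_range_self i)⟩

/-- The absolute logarithmic Weil height of the point of projective space whose homogeneous
coordinates are the (not all zero) algebraic numbers `x i`: the height relative to a number
field containing the coordinates, divided by the degree of that field. -/
def absLogHeight {ι : Type*} [Finite ι] (x : ι → Qbar) : ℝ :=
  Height.logHeight (toCoordField x) / (Module.finrank ℚ (coordField x) : ℝ)

/-- The finite set `S` of characters is full-dimensional: it is non-empty and its differences
span `ℝⁿ`. The set `{0, e₁, …, eₙ}` is of this kind, as is the set of lattice points of the
polytope of any very ample torus-invariant divisor on an `n`-dimensional projective toric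
variety. -/
def IsFullDimensional {n : ℕ} (S : Finset (CharLattice n)) : Prop :=
  S.Nonempty ∧
    Submodule.span ℝ {v : Fin n → ℝ | ∃ a ∈ S, ∃ b ∈ S, v = fun i => ((a i - b i : ℤ) : ℝ)} = ⊤

/-- The height of a point `P` of the torus with respect to the map
`P ↦ [P ^ a]_{a ∈ S}` to projective space. -/
def torusHeight {n : ℕ} (S : Finset (CharLattice n)) (P : Torus n) : ℝ :=
  absLogHeight fun a : S => (character a.1 P : Qbar)

/-- The sequence `h⁺(φ_A^k(P)) ^ (1/k)`, where `h⁺ = max h 1`. -/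
def degreeSeq {n : ℕ} (S : Finset (CharLattice n)) (A : Matrix (Fin n) (Fin n) ℤ)
    (P : Torus n) (k : ℕ) : ℝ :=
  (max (torusHeight S ((monomialMap A)^[k] P)) 1) ^ (1 / (k : ℝ))

/-- The arithmetic degree `α_φ(P)`, the limit of `h⁺(φ^k(P)) ^ (1/k)`. -/
def arithDegree {n : ℕ} (S : Finset (CharLattice n)) (A : Matrix (Fin n) (Fin n) ℤ)
    (P : Torus n) : ℝ :=
  limUnder atTop (degreeSeq S A P)

/-! ### Algebraic subgroups and invariant lattices -/

/-- The algebraic subgroup `𝔾_L` of the torus where all characters in `L` are trivial. -/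
def subgroupOfLattice {n : ℕ} (L : Submodule ℤ (CharLattice n)) : Subgroup (Torus n) where
  carrier := {P | ∀ a ∈ L, character a P = 1}
  one_mem' := fun a _ => by simp [character]
  mul_mem' := fun {P Q} hP hQ a ha => by
    have h : character a (P * Q) = character a P * character a Q := by
      simp [character, mul_zpow, Finset.prod_mul_distrib]
    rw [h, hP a ha, hQ a ha, one_mul]
  inv_mem' := fun {P} hP a ha => by
    have h : character a P⁻¹ = (character a P)⁻¹ := by
      simp [character]
    rw [h, hP a ha, inv_one]

/-- The divisible hull `G^div` of a subgroup of the torus. -/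
def divisibleHull {n : ℕ} (G : Subgroup (Torus n)) : Set (Torus n) :=
  {P | ∃ k : ℕ, 1 ≤ k ∧ P ^ k ∈ G}

/-- The sublattice `L` of `M` is saturated: `L = Span_ℝ(L) ∩ M`. -/
def IsSaturated {n : ℕ} (L : Submodule ℤ (CharLattice n)) : Prop :=
  ∀ m : CharLattice n,
    m ∈ L ↔ (fun i => (m i : ℝ)) ∈
      Submodule.span ℝ ((fun (a : CharLattice n) (i : Fin n) => (a i : ℝ)) '' (L : Set _))

/-- The action of the transpose of `A` on the character lattice. -/
abbrev transposeAction {n : ℕ} (A : Matrix (Fin n) (Fin n) ℤ) :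
    CharLattice n →ₗ[ℤ] CharLattice n :=
  Matrix.mulVecLin A.transpose

/-- The set of saturated sublattices of `M` that are invariant under the transpose of `A`. -/
def invariantLattices {n : ℕ} (A : Matrix (Fin n) (Fin n) ℤ) :
    Set (Submodule ℤ (CharLattice n)) :=
  {L | IsSaturated L ∧ L ≤ L.comap (transposeAction A)}

/-- The endomorphism of `M / L` induced by the transpose of `A`. -/
def quotientMap {n : ℕ} {A : Matrix (Fin n) (Fin n) ℤ} (L : invariantLattices A) :
    Module.End ℤ (CharLattice n ⧸ L.1) :=
  Submodule.mapQ L.1 L.1 (transposeAction A) L.2.2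

/-- The spectral radius `r(L)` of the induced map on `M / L`, the largest absolute value of a
complex eigenvalue of its extension to `ℂ ⊗ M / L` (and `0` if `L = M`). -/
def latticeRadius {n : ℕ} {A : Matrix (Fin n) (Fin n) ℤ} (L : invariantLattices A) : ENNReal :=
  spectralRadius ℂ
    (LinearMap.baseChange ℂ (quotientMap L) : Module.End ℂ (TensorProduct ℤ ℂ (CharLattice n ⧸ L.1)))

end

end MonomialDynamics

/-!
The height of the value at `Q` of a character is a seminorm `p` on the lattice `M = ℤⁿ`
(`charHeight`), and iterating the map acts on characters through `B`, the transpose of `A`. So the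
arithmetic degree is the exponential growth rate of `p` along the powers of `B`. The proof
determines it from three properties of `p`: it is homogeneous, its non-zero values are bounded away
from zero (Northcott), and it vanishes exactly at the characters that are torsion at `Q`
(Kronecker).

*Discrete seminorms.* On a finitely generated group, a discrete seminorm dominates every seminorm
vanishing on its kernel (`exists_seminorm_le_of_isDiscrete`). On `ℤ^r` this follows from
simultaneous Diophantine approximation: if `p a` were very small compared with `‖a‖`, some non-zero
integer vector close to a multiple of `a / ‖a‖` would have `p`-value below the gap. It takes the
place of the non-degeneracy statements that would otherwise come from the unit theorem.

*Growth.* Let `L` be the largest `B`-stable lattice on which `p` vanishes. By the Cayley-Hamilton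
theorem `L` is the kernel of a finite sum of seminorms `p ∘ B^l`, which is again discrete, so this
sum is comparable to the coordinate norm on the free group `M / L`. Gelfand's formula then gives the
growth rate `r(L)` (`tendsto_sum_seminorm_pow`).

*Independence of the field.* The height of a tuple is computed in the field that the tuple
generates, which changes along the orbit. It lies between the heights of the ratios of the
coordinates and their sum. Relative to two number fields, these heights are discrete seminorms with
the same kernel, hence comparable; and only finitely many fields occur, all of them subfields of the
field of definition of `Q` (`exists_absLogHeight_comparable_uniform`). No decomposition of places in
extensions is needed.

It follows that the arithmetic degree of `Q` is `max (r(L)) 1` (`tendsto_degreeSeq`). The point `Q`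
lies in the divisible hull of `𝔾_{L'}` exactly if `p` vanishes on `L'`; for invariant `L'` this
means `L' ⊆ L`, so that `M / L` is a quotient of `M / L'` and `r(L) ≤ r(L')`. This gives the
description of the sublevel sets, and finiteness holds since every `r(L)` is computed from a subset
of the eigenvalues of `B`.
-/

namespace MonomialDynamics
open Filter Topology

/-! ### Discrete seminorms on finitely generated abelian groups -/

/-- A bound for all seminorms at once: an element of the span of a finite family is dominated by
the values on the family. -/
lemma exists_seminorm_le_of_mem_span {G ι : Type*} [AddCommGroup G] [Fintype ι] {g : ι → G}
    {x : G} (hx : x ∈ Submodule.span ℤ (Set.range g)) :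
    ∃ C : ℝ, 0 ≤ C ∧ ∀ p : Seminorm ℤ G, p x ≤ C * ∑ i, p (g i) := by
  obtain ⟨c, rfl⟩ := (Submodule.mem_span_range_iff_exists_fun ℤ).1 hx
  refine ⟨∑ i, ‖c i‖, by positivity, fun p => ?_⟩
  calc p (∑ i, c i • g i) ≤ ∑ i, p (c i • g i) := by
        exact Finset.le_sum_of_subadditive p (map_zero p).le (map_add_le_add p) _ _
    _ = ∑ i, ‖c i‖ * p (g i) := by simp only [map_smul_eq_mul]
    _ ≤ ∑ i, (∑ j, ‖c j‖) * p (g i) := by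
        gcongr with i
        exact Finset.single_le_sum (f := fun j => ‖c j‖) (fun _ _ => norm_nonneg _)
          (Finset.mem_univ i)
    _ = _ := (Finset.mul_sum _ _ _).symm

/-- The version of `exists_seminorm_le_of_mem_span` for a finite family of elements, each of
which has a non-zero multiple in the span. -/
lemma exists_sum_seminorm_le_of_mem_span {G ι κ : Type*} [AddCommGroup G] [Fintype ι] [Fintype κ]
    {g : ι → G} {x : κ → G}
    (hx : ∀ j, ∃ q : ℕ, 1 ≤ q ∧ q • x j ∈ Submodule.span ℤ (Set.range g)) :
    ∃ C : ℝ, 0 ≤ C ∧ ∀ p : Seminorm ℤ G, ∑ j, p (x j) ≤ C * ∑ i, p (g i) := by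
  choose q hq hqx using hx
  choose C hC hCp using fun j => exists_seminorm_le_of_mem_span (hqx j)
  refine ⟨∑ j, C j, Finset.sum_nonneg fun j _ => hC j, fun p => ?_⟩
  rw [Finset.sum_mul]
  refine Finset.sum_le_sum fun j _ => le_trans ?_ (hCp j p)
  have h1 : (1 : ℝ) ≤ q j := by exact_mod_cast hq j
  have h2 : p (q j • x j) = q j * p (x j) := by
    rw [← natCast_zsmul, map_smul_eq_mul]; simp
  rw [h2]
  exact le_mul_of_one_le_left (apply_nonneg p _) h1

/-- Simultaneous Dirichlet approximation of the integer vector `a` of size at most `t`. -/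
lemma exists_simultaneous_approximation {ι : Type*} [Fintype ι] (a : ι → ℤ) {t : ℤ} (ht : 0 < t)
    {Q : ℕ} (hQ : 0 < Q) :
    ∃ (q : ℕ) (b : ι → ℤ), 1 ≤ q ∧ q ≤ Q ^ Fintype.card ι ∧
      ∀ i, |q * a i - t * b i| * Q ≤ t := by
  classical
  have hQ' : (0 : ℤ) < Q := by exact_mod_cast hQ
  -- The boxes of side length `t / Q` that contain the residues of the multiples of `a`.
  let box : ℕ → ι → Fin Q := fun k i => ⟨((k * a i % t) * Q / t).toNat, by
    have h0 := Int.emod_nonneg (k * a i) ht.ne'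
    have h1 := Int.emod_lt_of_pos (k * a i) ht
    have : (k * a i % t) * Q / t < Q := Int.ediv_lt_of_lt_mul ht (by nlinarith)
    have : 0 ≤ (k * a i % t) * Q / t := Int.ediv_nonneg (by positivity) ht.le
    omega⟩
  obtain ⟨x, hx, y, hy, hxy, hbox⟩ := Finset.exists_ne_map_eq_of_card_lt_of_maps_to
    (s := Finset.range (Q ^ Fintype.card ι + 1)) (t := (Finset.univ : Finset (ι → Fin Q)))
    (by simp) (f := box) (fun _ _ => Finset.mem_univ _)
  wlog hlt : x < y generalizing x y
  · exact this y hy x hx hxy.symm hbox.symm (by omega)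
  refine ⟨y - x, fun i => y * a i / t - x * a i / t, by omega, ?_, fun i => ?_⟩
  · have := Finset.mem_range.1 hy; omega
  have key : ∀ k : ℕ, 0 ≤ (k * a i % t) * Q / t := fun k =>
    Int.ediv_nonneg (mul_nonneg (Int.emod_nonneg _ ht.ne') hQ'.le) ht.le
  have hi : (x * a i % t) * Q / t = (y * a i % t) * Q / t := by
    have := congrArg Fin.val (congrFun hbox i)
    simp only [box] at this
    have h1 := key x
    have h2 := key y
    omega
  have ex := Int.emod_add_mul_ediv (x * a i) t
  have ey := Int.emod_add_mul_ediv (y * a i) t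
  have hsub : (((y - x : ℕ) : ℤ)) * a i - t * (y * a i / t - x * a i / t)
      = y * a i % t - x * a i % t := by
    rw [Nat.cast_sub hlt.le]; linear_combination ex - ey
  rw [hsub, ← abs_of_pos hQ', ← abs_mul, sub_mul]
  have dx := Int.emod_add_mul_ediv ((x * a i % t) * Q) t
  have dy := Int.emod_add_mul_ediv ((y * a i % t) * Q) t
  have := Int.emod_nonneg ((x * a i % t) * Q) ht.ne'
  have := Int.emod_nonneg ((y * a i % t) * Q) ht.ne'
  have := Int.emod_lt_of_pos ((x * a i % t) * Q) ht
  have := Int.emod_lt_of_pos ((y * a i % t) * Q) ht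
  rw [hi] at dx
  rw [abs_le]
  constructor <;> linarith

/-- A seminorm is discrete if its non-zero values are bounded away from zero. -/
def IsDiscrete {G : Type*} [AddCommGroup G] (p : Seminorm ℤ G) : Prop :=
  ∃ δ : ℝ, 0 < δ ∧ ∀ g, p g ≠ 0 → δ ≤ p g

/-- The kernel of a seminorm, as a submodule. -/
def seminormKer {G : Type*} [AddCommGroup G] (p : Seminorm ℤ G) : Submodule ℤ G where
  carrier := {g | p g = 0}
  zero_mem' := map_zero p
  add_mem' {a b} ha hb := le_antisymm ((map_add_le_add p a b).trans (by
    rw [Set.mem_ofPred_eq] at ha hb; rw [ha, hb, add_zero])) (apply_nonneg p _)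
  smul_mem' c x hx := by
    rw [Set.mem_ofPred_eq] at hx ⊢; rw [map_smul_eq_mul, hx, mul_zero]

lemma mem_seminormKer {G : Type*} [AddCommGroup G] {p : Seminorm ℤ G} {g : G} :
    g ∈ seminormKer p ↔ p g = 0 := Iff.rfl

/-- A quotient of a finitely generated group by a submodule closed under division is free. -/
lemma free_quotient_of_nsmul_mem {G : Type*} [AddCommGroup G] [Module.Finite ℤ G]
    {T : Submodule ℤ G} (hT : ∀ (q : ℤ) (g : G), q ≠ 0 → q • g ∈ T → g ∈ T) :
    Module.Free ℤ (G ⧸ T) := by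
  have : Module.IsTorsionFree ℤ (G ⧸ T) := by
    refine Module.IsTorsionFree.of_smul_eq_zero fun q y h => ?_
    obtain ⟨g, rfl⟩ := T.mkQ_surjective y
    rw [← map_smul, Submodule.mkQ_apply, Submodule.Quotient.mk_eq_zero] at h
    rw [or_iff_not_imp_left]
    intro hq
    rw [Submodule.mkQ_apply, Submodule.Quotient.mk_eq_zero]
    exact hT q g hq h
  exact Module.free_of_finite_type_torsion_free'

/-- A discrete norm on `ℤ^r` dominates the sum norm. If `‖a‖ = t` and `q a / t` is very
close to the integer vector `b ≠ 0`, then `q p(a) / t` is close to `p b ≥ δ`. -/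
lemma exists_sum_abs_le_of_isDiscrete {ι : Type*} [Fintype ι] (p : Seminorm ℤ (ι → ℤ))
    (hp : IsDiscrete p) (h0 : ∀ a, p a = 0 → a = 0) :
    ∃ C : ℝ, 0 ≤ C ∧ ∀ a, ∑ i, |(a i : ℝ)| ≤ C * p a := by
  classical
  obtain ⟨δ, hδ, hgap⟩ := hp
  set K : ℝ := ∑ i, p (Pi.single i 1) with hK
  have hK0 : 0 ≤ K := Finset.sum_nonneg fun i _ => apply_nonneg p _
  have hpK : ∀ (a : ι → ℤ) (B : ℝ), (∀ i, |(a i : ℝ)| ≤ B) → p a ≤ B * K := by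
    intro a B hB
    have ha : a = ∑ i, a i • (Pi.single i 1 : ι → ℤ) := by
      ext j; simp [Finset.sum_apply, Pi.single_apply]
    calc p a ≤ ∑ i, p (a i • (Pi.single i 1 : ι → ℤ)) := by
          conv_lhs => rw [ha]
          exact Finset.le_sum_of_subadditive p (map_zero p).le (map_add_le_add p) _ _
      _ ≤ ∑ i, B * p (Pi.single i 1) := by
          gcongr with i
          rw [map_smul_eq_mul, Int.norm_eq_abs]
          exact mul_le_mul_of_nonneg_right (hB i) (apply_nonneg p _)
      _ = B * K := (Finset.mul_sum _ _ _).symm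
  -- `Q` is so large that the error `p (q a - t b) / t ≤ K / Q` is at most half of the gap `δ`.
  obtain ⟨Q, hQ⟩ := exists_nat_gt (max 2 (2 * K / δ))
  have hQ2 : (2 : ℝ) < Q := (le_max_left _ _).trans_lt hQ
  have hQ0 : (0 : ℝ) < Q := by linarith
  have hQK : K / Q ≤ δ / 2 := by
    have := (le_max_right _ _).trans_lt hQ
    rw [div_lt_iff₀ hδ] at this
    rw [div_le_iff₀ hQ0]; linarith
  set R : ℝ := (Q : ℝ) ^ Fintype.card ι with hR
  refine ⟨Fintype.card ι * (R * (2 / δ)), by positivity, fun a => ?_⟩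
  by_cases ha : a = 0
  · simp [ha]
  obtain ⟨i₀, hi₀⟩ := Function.ne_iff.1 ha
  obtain ⟨m, -, hm⟩ := Finset.exists_max_image Finset.univ (fun i => |a i|) ⟨i₀, Finset.mem_univ _⟩
  set t : ℤ := |a m| with ht
  have ht0 : 0 < t := (abs_pos.2 hi₀).trans_le (hm i₀ (Finset.mem_univ _))
  have ht0' : (0 : ℝ) < t := by exact_mod_cast ht0
  obtain ⟨q, b, hq1, hqR, hqb⟩ := exists_simultaneous_approximation a ht0
    (Q := Q) (by exact_mod_cast hQ0)
  have hq1' : (1 : ℝ) ≤ q := by exact_mod_cast hq1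
  -- Otherwise `q |a m| ≤ t / Q` for the coordinate with `|a m| = t`.
  have hb : b ≠ 0 := by
    rintro rfl
    have h := hqb m
    simp only [Pi.zero_apply, mul_zero, sub_zero, abs_mul, ← ht] at h
    have h' : ((|(q : ℤ)| * t * Q : ℤ) : ℝ) ≤ t := by exact_mod_cast h
    push_cast at h'
    rw [abs_of_nonneg (by positivity)] at h'
    nlinarith [mul_pos ht0' hQ0]
  have hpb : δ ≤ p b := hgap b fun h => hb (h0 b h)
  have herr : p ((q : ℤ) • a - t • b) ≤ t / Q * K := by
    refine hpK _ _ fun i => ?_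
    rw [le_div_iff₀ hQ0]
    have := hqb i
    simp only [Pi.sub_apply, Pi.smul_apply, smul_eq_mul]
    exact_mod_cast this
  have htb : t * p b ≤ q * p a + t / Q * K := by
    calc t * p b = p (t • b) := by
          rw [map_smul_eq_mul, Int.norm_eq_abs, abs_of_pos ht0']
      _ = p ((q : ℤ) • a - ((q : ℤ) • a - t • b)) := by congr 1; abel
      _ ≤ p ((q : ℤ) • a) + p ((q : ℤ) • a - t • b) := map_sub_le_add p _ _
      _ ≤ _ := by
          rw [map_smul_eq_mul]
          simpa using herr
  have hqR' : (q : ℝ) ≤ R := by rw [hR]; exact_mod_cast hqR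
  have hfin : t ≤ R * (2 / δ) * p a := by
    have h1 : t / Q * K ≤ t * (δ / 2) := by
      rw [div_mul_eq_mul_div, mul_div_assoc]
      exact mul_le_mul_of_nonneg_left hQK ht0'.le
    have h2 : q * p a ≤ R * p a := mul_le_mul_of_nonneg_right hqR' (apply_nonneg p _)
    have h3 : t * δ ≤ t * p b := mul_le_mul_of_nonneg_left hpb ht0'.le
    have h4 : R * (2 / δ) * p a = R * p a * 2 / δ := by ring
    rw [h4, le_div_iff₀ hδ]
    linarith
  calc ∑ i, |(a i : ℝ)| ≤ ∑ i : ι, (t : ℝ) :=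
        Finset.sum_le_sum fun i hi => by exact_mod_cast hm i hi
    _ = Fintype.card ι * t := by simp
    _ ≤ _ := by
        rw [mul_assoc (Fintype.card ι : ℝ)]
        exact mul_le_mul_of_nonneg_left hfin (by positivity)

/-- On a finitely generated group a discrete seminorm dominates every seminorm that vanishes on
its kernel. This replaces the equivalence of norms on a finite-dimensional real vector space;
without discreteness it fails, as for `p (a, b) = |a + √2 b|` on `ℤ²`. -/
lemma exists_seminorm_le_of_isDiscrete {G : Type*} [AddCommGroup G] [Module.Finite ℤ G]
    (p r : Seminorm ℤ G) (hp : IsDiscrete p) (h0 : ∀ g, p g = 0 → r g = 0) :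
    ∃ C : ℝ, 0 ≤ C ∧ ∀ g, r g ≤ C * p g := by
  classical
  set T := seminormKer p with hT
  have : Module.Free ℤ (G ⧸ T) := free_quotient_of_nsmul_mem fun q g hq h => by
    rw [hT, mem_seminormKer, map_smul_eq_mul] at h
    exact (mul_eq_zero.1 h).resolve_left (by simpa using hq)
  let b := Module.Free.chooseBasis ℤ (G ⧸ T)
  choose u hu using fun i => T.mkQ_surjective (b i)
  let f : (Module.Free.ChooseBasisIndex ℤ (G ⧸ T) → ℤ) →ₗ[ℤ] G := Fintype.linearCombination ℤ u
  have hf : ∀ a, T.mkQ (f a) = ∑ i, a i • b i := fun a => by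
    simp [f, Fintype.linearCombination_apply, hu, -Submodule.mkQ_apply]
  obtain ⟨δ, hδ, hgap⟩ := hp
  obtain ⟨C, hC, hCp⟩ := exists_sum_abs_le_of_isDiscrete (p.comp f)
    ⟨δ, hδ, fun a ha => hgap _ ha⟩ (fun a ha => by
      have h1 : T.mkQ (f a) = 0 := by
        rw [Submodule.mkQ_apply, Submodule.Quotient.mk_eq_zero]; exact ha
      rw [hf] at h1
      funext i
      simpa using Fintype.linearIndependent_iff.1 b.linearIndependent a h1 i)
  have hr0 : 0 ≤ ∑ i, r (u i) := Finset.sum_nonneg fun i _ => apply_nonneg r _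
  refine ⟨(∑ i, r (u i)) * C, by positivity, fun g => ?_⟩
  set a : Module.Free.ChooseBasisIndex ℤ (G ⧸ T) → ℤ := ⇑(b.repr (T.mkQ g)) with ha
  have hdiff : p (g - f a) = 0 := by
    rw [← mem_seminormKer, ← hT, ← Submodule.Quotient.mk_eq_zero, ← Submodule.mkQ_apply, map_sub,
      hf, ha, b.sum_repr, sub_self]
  have hdiff' : p (f a - g) = 0 := by rw [map_sub_rev, hdiff]
  have hle : ∀ s : Seminorm ℤ G, ∀ x y, s (x - y) = 0 → s x ≤ s y := fun s x y h => by
    have := map_add_le_add s (x - y) y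
    rwa [sub_add_cancel, h, zero_add] at this
  calc r g ≤ r (f a) := hle r _ _ (h0 _ hdiff)
    _ ≤ ∑ i, r (a i • u i) := by
        rw [show f a = ∑ i, a i • u i from Fintype.linearCombination_apply ..]
        exact Finset.le_sum_of_subadditive r (map_zero r).le (map_add_le_add r) _ _
    _ ≤ ∑ i, r (u i) * ∑ j, |(a j : ℝ)| := by
        gcongr with i
        rw [map_smul_eq_mul, mul_comm, Int.norm_eq_abs]
        gcongr
        exact Finset.single_le_sum (f := fun j => |(a j : ℝ)|) (fun _ _ => abs_nonneg _)
          (Finset.mem_univ i)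
    _ = (∑ i, r (u i)) * ∑ j, |(a j : ℝ)| := (Finset.sum_mul _ _ _).symm
    _ ≤ (∑ i, r (u i)) * (C * p (f a)) := by gcongr; exact hCp a
    _ ≤ (∑ i, r (u i)) * (C * p g) := by gcongr; exact hle p _ _ hdiff'
    _ = _ := by ring

/-! ### Exponential growth rates -/

lemma tendsto_const_rpow_one_div {C : ℝ} (hC : 0 < C) :
    Tendsto (fun k : ℕ => C ^ (1 / (k : ℝ))) atTop (𝓝 1) := by
  have h := (Real.continuousAt_const_rpow (b := 0) hC.ne').tendsto.comp
    (tendsto_one_div_atTop_nhds_zero_nat (𝕜 := ℝ))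
  rwa [Real.rpow_zero] at h

/-- Sequences that agree up to constant factors have the same exponential growth rate. -/
lemma tendsto_rpow_one_div_of_le {u t : ℕ → ℝ} {C₁ C₂ r : ℝ} (hu : ∀ k, 0 ≤ u k)
    (ht : ∀ k, 0 ≤ t k) (h₁ : ∀ k, t k ≤ C₁ * u k) (h₂ : ∀ k, u k ≤ C₂ * t k)
    (hr : Tendsto (fun k : ℕ => u k ^ (1 / (k : ℝ))) atTop (𝓝 r)) :
    Tendsto (fun k : ℕ => t k ^ (1 / (k : ℝ))) atTop (𝓝 r) := by
  set D₁ := max C₁ 1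
  set D₂ := max C₂ 1
  have hD₁ : 0 < D₁ := zero_lt_one.trans_le (le_max_right _ _)
  have hD₂ : 0 < D₂ := zero_lt_one.trans_le (le_max_right _ _)
  have lower := (tendsto_const_rpow_one_div (inv_pos.2 hD₂)).mul hr
  have upper := (tendsto_const_rpow_one_div hD₁).mul hr
  rw [one_mul] at lower upper
  refine tendsto_of_tendsto_of_tendsto_of_le_of_le lower upper (fun k => ?_) (fun k => ?_)
  · simp only
    rw [← Real.mul_rpow (inv_pos.2 hD₂).le (hu k)]
    refine Real.rpow_le_rpow (mul_nonneg (inv_pos.2 hD₂).le (hu k)) ?_ (by positivity)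
    rw [inv_mul_le_iff₀ hD₂]
    exact (h₂ k).trans (mul_le_mul_of_nonneg_right (le_max_left _ _) (ht k))
  · simp only
    rw [← Real.mul_rpow hD₁.le (hu k)]
    refine Real.rpow_le_rpow (ht k) ?_ (by positivity)
    exact (h₁ k).trans (mul_le_mul_of_nonneg_right (le_max_left _ _) (hu k))

/-! ### Spectra of endomorphisms and Gelfand's formula -/

section Spectrum

lemma spectrum_subset_of_surjective {V W : Type*} [AddCommGroup V] [Module ℂ V]
    [AddCommGroup W] [Module ℂ W] [FiniteDimensional ℂ W] {f : Module.End ℂ V}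
    {g : Module.End ℂ W} {π : V →ₗ[ℂ] W} (hπ : Function.Surjective π) (h : π ∘ₗ f = g ∘ₗ π) :
    spectrum ℂ g ⊆ spectrum ℂ f := by
  intro z hz hf
  refine hz ?_
  rw [spectrum.mem_resolventSet_iff, Module.End.isUnit_iff] at hf ⊢
  rw [Function.Bijective, LinearMap.injective_iff_surjective, and_self]
  intro w
  obtain ⟨v, rfl⟩ := hπ w
  obtain ⟨x, rfl⟩ := hf.2 v
  refine ⟨π x, ?_⟩
  have := LinearMap.congr_fun h x
  simp only [LinearMap.comp_apply] at this
  simp [this]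

lemma spectrum_baseChange_subset_of_surjective {G H : Type*} [AddCommGroup G] [AddCommGroup H]
    [Module.Finite ℤ H] {f : Module.End ℤ G} {g : Module.End ℤ H} {π : G →ₗ[ℤ] H}
    (hπ : Function.Surjective π) (h : π ∘ₗ f = g ∘ₗ π) :
    spectrum ℂ (LinearMap.baseChange ℂ g : Module.End ℂ (TensorProduct ℤ ℂ H)) ⊆
      spectrum ℂ (LinearMap.baseChange ℂ f : Module.End ℂ (TensorProduct ℤ ℂ G)) := by
  refine spectrum_subset_of_surjective (π := π.baseChange ℂ) ?_ ?_
  · exact LinearMap.lTensor_surjective ℂ hπ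
  · rw [← LinearMap.baseChange_comp, h, LinearMap.baseChange_comp]

lemma spectralRadius_baseChange_lt_top {G : Type*} [AddCommGroup G] [Module.Finite ℤ G]
    (f : Module.End ℤ G) :
    spectralRadius ℂ (LinearMap.baseChange ℂ f : Module.End ℂ (TensorProduct ℤ ℂ G)) < ⊤ := by
  have hfin := Module.End.finite_spectrum
    (LinearMap.baseChange ℂ f : Module.End ℂ (TensorProduct ℤ ℂ G))
  obtain ⟨B, hB⟩ := (hfin.image fun z => ‖z‖₊).bddAbove
  refine lt_of_le_of_lt (iSup₂_le fun z hz => ?_) (ENNReal.coe_lt_top (r := B))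
  exact ENNReal.coe_le_coe.2 (hB ⟨z, hz, rfl⟩)

attribute [local instance] Matrix.linftyOpNormedRing Matrix.linftyOpNormedAlgebra

/-- Gelfand's formula for an endomorphism of a free abelian group, with the sum of the absolute
values of the matrix entries in place of an operator norm. -/
lemma tendsto_sum_abs_repr_pow {V κ : Type*} [AddCommGroup V] [Fintype κ] (b : Module.Basis κ ℤ V)
    (f : Module.End ℤ V) :
    Tendsto (fun k : ℕ => (∑ j, ∑ i, |((b.repr ((f ^ k) (b j)) i : ℤ) : ℝ)|) ^ (1 / (k : ℝ)))
      atTop (𝓝 (spectralRadius ℂ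
        (LinearMap.baseChange ℂ f : Module.End ℂ (TensorProduct ℤ ℂ V))).toReal) := by
  classical
  have : Module.Finite ℤ V := Module.Finite.of_basis b
  let c := b.baseChange ℂ
  set X : Matrix κ κ ℂ := LinearMap.toMatrixAlgEquiv c (LinearMap.baseChange ℂ f) with hX
  have hspec : spectralRadius ℂ X = spectralRadius ℂ
      (LinearMap.baseChange ℂ f : Module.End ℂ (TensorProduct ℤ ℂ V)) := by
    simp only [spectralRadius, hX, AlgEquiv.spectrum_eq]
  have hpow : ∀ k : ℕ, ((LinearMap.baseChange ℂ f : Module.End ℂ (TensorProduct ℤ ℂ V))) ^ k =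
      LinearMap.baseChange ℂ (f ^ k) := fun k => by
    induction k with
    | zero => simp [Module.End.one_eq_id, LinearMap.baseChange_id]
    | succ k ih => rw [pow_succ, ih, pow_succ, Module.End.mul_eq_comp, Module.End.mul_eq_comp,
        LinearMap.baseChange_comp]
  have hentry : ∀ k i j, (X ^ k) i j = ((b.repr ((f ^ k) (b j)) i : ℤ) : ℂ) := fun k i j => by
    rw [hX, ← map_pow, hpow, LinearMap.toMatrixAlgEquiv_apply]
    simp [c, Module.Basis.baseChange_apply, Module.Basis.baseChange_repr_tmul]
  have hgel := spectrum.pow_norm_pow_one_div_tendsto_nhds_spectralRadius X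
  rw [hspec] at hgel
  have hgel' := (ENNReal.tendsto_toReal
    (spectralRadius_baseChange_lt_top f).ne).comp hgel
  have hgel'' : Tendsto (fun k : ℕ => ‖X ^ k‖ ^ (1 / (k : ℝ))) atTop (𝓝 (spectralRadius ℂ
        (LinearMap.baseChange ℂ f : Module.End ℂ (TensorProduct ℤ ℂ V))).toReal) := by
    refine hgel'.congr fun k => ?_
    exact ENNReal.toReal_ofReal (by positivity)
  have habs : ∀ k i j, |((b.repr ((f ^ k) (b j)) i : ℤ) : ℝ)| = ‖(X ^ k) i j‖ := fun k i j => by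
    rw [hentry]; simp
  simp only [habs]
  have hnorm : ∀ Y : Matrix κ κ ℂ, ‖Y‖ ≤ 1 * ∑ j, ∑ i, ‖Y i j‖ := fun Y => by
    rw [one_mul, Finset.sum_comm, Matrix.linfty_opNorm_def]
    have : ∑ i, ∑ j, ‖Y i j‖ = ((∑ i, ∑ j, ‖Y i j‖₊ : NNReal) : ℝ) := by push_cast; rfl
    rw [this, NNReal.coe_le_coe]
    exact Finset.sup_le fun i hi => Finset.single_le_sum (f := fun i => ∑ j, ‖Y i j‖₊)
      (fun _ _ => zero_le) hi
  have hnorm' : ∀ Y : Matrix κ κ ℂ, ∑ j, ∑ i, ‖Y i j‖ ≤ Fintype.card κ * ‖Y‖ := fun Y => by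
    rw [Finset.sum_comm]
    calc ∑ i, ∑ j, ‖Y i j‖ ≤ ∑ i : κ, ‖Y‖ := Finset.sum_le_sum fun i hi => by
          rw [Matrix.linfty_opNorm_def]
          have : ∑ j, ‖Y i j‖ = ((∑ j, ‖Y i j‖₊ : NNReal) : ℝ) := by push_cast; rfl
          rw [this, NNReal.coe_le_coe]
          exact Finset.le_sup (f := fun i => ∑ j, ‖Y i j‖₊) hi
      _ = _ := by simp
  exact tendsto_rpow_one_div_of_le (fun k => norm_nonneg _)
    (fun k => Finset.sum_nonneg fun j _ => Finset.sum_nonneg fun i _ => norm_nonneg _)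
    (fun k => hnorm' _) (fun k => hnorm _) hgel''

end Spectrum

/-! ### Growth of discrete seminorms along an endomorphism -/

section Growth

variable {G : Type*} [AddCommGroup G]

/-- The largest submodule stable under `β` on which the seminorm `p` vanishes. -/
def invariantKernel (β : Module.End ℤ G) (p : Seminorm ℤ G) : Submodule ℤ G :=
  ⨅ k : ℕ, (seminormKer p).comap (β ^ k)

lemma mem_invariantKernel {β : Module.End ℤ G} {p : Seminorm ℤ G} {g : G} :
    g ∈ invariantKernel β p ↔ ∀ k, p ((β ^ k) g) = 0 := by
  simp [invariantKernel, mem_seminormKer]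

lemma invariantKernel_le_comap (β : Module.End ℤ G) (p : Seminorm ℤ G) :
    invariantKernel β p ≤ (invariantKernel β p).comap β := fun g hg => by
  rw [Submodule.mem_comap, mem_invariantKernel]
  intro k
  rw [← Module.End.mul_apply, ← pow_succ]
  exact mem_invariantKernel.1 hg (k + 1)

lemma mem_invariantKernel_of_zsmul_mem {β : Module.End ℤ G} {p : Seminorm ℤ G} {g : G} {q : ℤ}
    (hq : q ≠ 0) (h : q • g ∈ invariantKernel β p) : g ∈ invariantKernel β p := by
  rw [mem_invariantKernel] at h ⊢
  intro k
  have := h k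
  rw [map_smul, map_smul_eq_mul] at this
  exact (mul_eq_zero.1 this).resolve_left (by simpa using hq)

/-- By the Cayley-Hamilton theorem finitely many powers of `β` suffice to cut out the invariant
kernel. -/
lemma exists_mem_invariantKernel_of_lt [Module.Finite ℤ G] (β : Module.End ℤ G)
    (p : Seminorm ℤ G) :
    ∃ d : ℕ, ∀ g, (∀ k < d, p ((β ^ k) g) = 0) → g ∈ invariantKernel β p := by
  obtain ⟨f, hf, hf0⟩ := Algebra.IsIntegral.isIntegral (R := ℤ) β
  refine ⟨f.natDegree, fun g hg => mem_invariantKernel.2 fun k => ?_⟩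
  have h1 : β ^ k = Polynomial.aeval β (Polynomial.X ^ k %ₘ f) := by
    have := congrArg (Polynomial.aeval β) (Polynomial.modByMonic_add_div (Polynomial.X ^ k) f)
    rw [map_add, map_mul, Polynomial.aeval_def β f, hf0, zero_mul, add_zero] at this
    simpa using this.symm
  have h2 : Polynomial.aeval β (Polynomial.X ^ k %ₘ f) ∈
      Submodule.span ℤ ((fun l => β ^ l) '' {l | l < f.natDegree}) := by
    by_cases h1 : f = 1
    · subst h1; simp
    rw [Polynomial.aeval_eq_sum_range]
    refine Submodule.sum_mem _ fun l hl => Submodule.smul_mem _ _ (Submodule.subset_span ⟨l, ?_, rfl⟩)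
    have := Polynomial.natDegree_modByMonic_lt (Polynomial.X ^ k) hf h1
    rw [Finset.mem_range] at hl
    exact Set.mem_ofPred.2 (by omega)
  rw [← h1] at h2
  rw [← mem_seminormKer]
  refine Submodule.span_induction (p := fun γ _ => γ g ∈ seminormKer p) ?_ ?_ ?_ ?_ h2
  · rintro _ ⟨l, hl, rfl⟩
    exact hg l hl
  · simp
  · intro x y _ _ hx hy
    exact Submodule.add_mem _ hx hy
  · intro c x _ hx
    exact Submodule.smul_mem _ c hx

lemma seminorm_sum_apply {ι : Type*} (s : Finset ι) (p : ι → Seminorm ℤ G) (g : G) :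
    (∑ i ∈ s, p i) g = ∑ i ∈ s, p i g := by
  classical
  induction s using Finset.induction_on with
  | empty => simp
  | insert a s ha ih => rw [Finset.sum_insert ha, Finset.sum_insert ha, add_apply, ih]

lemma IsDiscrete.sum {ι : Type*} (s : Finset ι) {p : ι → Seminorm ℤ G}
    (hp : ∀ i, IsDiscrete (p i)) : IsDiscrete (∑ i ∈ s, p i) := by
  classical
  choose δ hδ hgap using hp
  have hpos : ∃ ε : ℝ, 0 < ε ∧ ∀ i ∈ s, ε ≤ δ i := by
    induction s using Finset.induction_on with
    | empty => exact ⟨1, one_pos, by simp⟩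
    | insert a s _ ih =>
      obtain ⟨ε, hε, h⟩ := ih
      refine ⟨min ε (δ a), lt_min hε (hδ a), fun i hi => ?_⟩
      rcases Finset.mem_insert.1 hi with rfl | hi
      · exact min_le_right _ _
      · exact (min_le_left _ _).trans (h i hi)
  obtain ⟨ε, hε, h⟩ := hpos
  refine ⟨ε, hε, fun g hg => ?_⟩
  rw [seminorm_sum_apply] at hg ⊢
  obtain ⟨i, hi, hne⟩ := Finset.exists_ne_zero_of_sum_ne_zero hg
  exact (h i hi).trans ((hgap i g hne).trans
    (Finset.single_le_sum (f := fun i => p i g) (fun _ _ => apply_nonneg _ _) hi))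

lemma IsDiscrete.comp {H : Type*} [AddCommGroup H] {p : Seminorm ℤ G} (hp : IsDiscrete p)
    (f : H →ₗ[ℤ] G) : IsDiscrete (p.comp f) := by
  obtain ⟨δ, hδ, hgap⟩ := hp
  exact ⟨δ, hδ, fun g hg => hgap _ hg⟩

/-- The sum norm with respect to a basis. -/
noncomputable def basisSeminorm {κ : Type*} [Fintype κ] (b : Module.Basis κ ℤ G) : Seminorm ℤ G :=
  Seminorm.of (fun g => ∑ i, |((b.repr g i : ℤ) : ℝ)|)
    (fun x y => by
      rw [← Finset.sum_add_distrib]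
      refine Finset.sum_le_sum fun i _ => ?_
      rw [map_add, Finsupp.add_apply, Int.cast_add]
      exact abs_add_le _ _)
    (fun c x => by
      rw [Finset.mul_sum]
      refine Finset.sum_congr rfl fun i _ => ?_
      rw [map_smul, Finsupp.smul_apply, smul_eq_mul, Int.cast_mul, abs_mul, Int.norm_eq_abs])

lemma basisSeminorm_apply {κ : Type*} [Fintype κ] (b : Module.Basis κ ℤ G) (g : G) :
    basisSeminorm b g = ∑ i, |((b.repr g i : ℤ) : ℝ)| := rfl

lemma basisSeminorm_eq_zero {κ : Type*} [Fintype κ] {b : Module.Basis κ ℤ G} {g : G} :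
    basisSeminorm b g = 0 ↔ g = 0 := by
  rw [basisSeminorm_apply, Finset.sum_eq_zero_iff_of_nonneg fun _ _ => abs_nonneg _]
  simp only [Finset.mem_univ, abs_eq_zero, Int.cast_eq_zero, forall_const]
  rw [← b.forall_coord_eq_zero_iff]
  rfl

lemma isDiscrete_basisSeminorm {κ : Type*} [Fintype κ] (b : Module.Basis κ ℤ G) :
    IsDiscrete (basisSeminorm b) := by
  refine ⟨1, one_pos, fun g hg => ?_⟩
  have h : basisSeminorm b g = ((∑ i, |b.repr g i| : ℤ) : ℝ) := by
    rw [basisSeminorm_apply]; push_cast; rfl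
  have h0 : (0 : ℝ) < basisSeminorm b g := lt_of_le_of_ne (apply_nonneg _ _) hg.symm
  rw [h] at h0 ⊢
  exact_mod_cast h0

/-- The growth of a discrete seminorm along the iterates of `β` is governed by the spectral radius
of the map induced by `β` on the quotient by the invariant kernel. -/
theorem tendsto_sum_seminorm_pow [Module.Finite ℤ G] (β : Module.End ℤ G) {p : Seminorm ℤ G}
    (hp : IsDiscrete p) {ι : Type*} [Fintype ι] {g : ι → G}
    (hg : Submodule.span ℤ (Set.range g) = ⊤) :
    Tendsto (fun k : ℕ => (∑ i, p ((β ^ k) (g i))) ^ (1 / (k : ℝ))) atTop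
      (𝓝 (spectralRadius ℂ (LinearMap.baseChange ℂ
        (Submodule.mapQ (invariantKernel β p) (invariantKernel β p) β
          (invariantKernel_le_comap β p)) : Module.End ℂ
            (TensorProduct ℤ ℂ (G ⧸ invariantKernel β p)))).toReal) := by
  classical
  set L := invariantKernel β p with hL
  set γ : Module.End ℤ (G ⧸ L) := L.mapQ L β (invariantKernel_le_comap β p) with hγ
  have : Module.Free ℤ (G ⧸ L) := free_quotient_of_nsmul_mem fun q g hq h =>
    mem_invariantKernel_of_zsmul_mem hq h
  let b := Module.Free.chooseBasis ℤ (G ⧸ L)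
  have hγk : ∀ (k : ℕ) (x : G), (γ ^ k) (L.mkQ x) = L.mkQ ((β ^ k) x) := fun k x => by
    induction k generalizing x with
    | zero => rfl
    | succ k ih =>
      rw [pow_succ, Module.End.mul_apply, pow_succ, Module.End.mul_apply, ← ih]
      rfl
  -- The seminorm `s`, a sum over the first few iterates, has kernel exactly `L`.
  obtain ⟨d, hd⟩ := exists_mem_invariantKernel_of_lt β p
  set s : Seminorm ℤ G := ∑ l ∈ Finset.range (d + 1), p.comp (β ^ l) with hs
  have hsapp : ∀ x, s x = ∑ l ∈ Finset.range (d + 1), p ((β ^ l) x) := fun x => by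
    rw [hs, seminorm_sum_apply]; rfl
  have hsker : ∀ x, s x = 0 ↔ x ∈ L := fun x => by
    rw [hsapp, Finset.sum_eq_zero_iff_of_nonneg fun _ _ => apply_nonneg p _]
    refine ⟨fun h => hd x fun k hk => h k (Finset.mem_range.2 (by omega)), fun h l _ => ?_⟩
    exact mem_invariantKernel.1 h l
  have hsdisc : IsDiscrete s := IsDiscrete.sum _ fun l => hp.comp _
  set N : Seminorm ℤ (G ⧸ L) := basisSeminorm b with hN
  have hNker : ∀ x, (N.comp L.mkQ) x = 0 ↔ x ∈ L := fun x => by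
    rw [Seminorm.comp_apply, hN, basisSeminorm_eq_zero, Submodule.mkQ_apply,
      Submodule.Quotient.mk_eq_zero]
  obtain ⟨C₁, hC₁, h₁⟩ := exists_seminorm_le_of_isDiscrete s (N.comp L.mkQ) hsdisc
    fun x h => (hNker x).2 ((hsker x).1 h)
  obtain ⟨C₂, hC₂, h₂⟩ := exists_seminorm_le_of_isDiscrete (N.comp L.mkQ) s
    ((isDiscrete_basisSeminorm b).comp _) fun x h => (hsker x).2 ((hNker x).1 h)
  have hgq : Submodule.span ℤ (Set.range fun i => L.mkQ (g i)) = ⊤ := by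
    have : (Set.range fun i => L.mkQ (g i)) = L.mkQ '' Set.range g := by
      rw [← Set.range_comp]; rfl
    rw [this, Submodule.span_image, hg, Submodule.map_top, Submodule.range_mkQ]
  obtain ⟨C₃, hC₃, h₃⟩ := exists_sum_seminorm_le_of_mem_span (g := b) (x := fun i => L.mkQ (g i))
    fun j => ⟨1, le_rfl, by rw [b.span_eq]; trivial⟩
  obtain ⟨C₄, hC₄, h₄⟩ := exists_sum_seminorm_le_of_mem_span (g := fun i => L.mkQ (g i)) (x := b)
    fun j => ⟨1, le_rfl, by rw [hgq]; trivial⟩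
  obtain ⟨C₅, hC₅, h₅⟩ := exists_sum_seminorm_le_of_mem_span (g := g)
    (x := fun y : ι × Fin (d + 1) => (β ^ (y.2 : ℕ)) (g y.1))
    fun j => ⟨1, le_rfl, by rw [hg]; trivial⟩
  have hNsum : ∀ k, ∑ i, (N.comp (γ ^ k)) (L.mkQ (g i)) =
      ∑ i, (N.comp L.mkQ) ((β ^ k) (g i)) := fun k => by
    refine Finset.sum_congr rfl fun i _ => ?_
    rw [Seminorm.comp_apply, Seminorm.comp_apply, hγk]
  have hps : ∀ x, p x ≤ s x := fun x => by
    rw [hsapp]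
    exact Finset.single_le_sum (f := fun l => p ((β ^ l) x)) (fun _ _ => apply_nonneg p _)
      (Finset.mem_range.2 (Nat.succ_pos d))
  refine tendsto_rpow_one_div_of_le (C₁ := C₂ * C₃) (C₂ := C₄ * (C₁ * C₅))
    (fun k => ?_) (fun k => ?_) (fun k => ?_) (fun k => ?_) (tendsto_sum_abs_repr_pow b γ)
  · positivity
  · exact Finset.sum_nonneg fun i _ => apply_nonneg p _
  · calc ∑ i, p ((β ^ k) (g i)) ≤ ∑ i, C₂ * (N.comp L.mkQ) ((β ^ k) (g i)) :=
          Finset.sum_le_sum fun i _ => (hps _).trans (h₂ _)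
      _ = C₂ * ∑ i, (N.comp (γ ^ k)) (L.mkQ (g i)) := by rw [← Finset.mul_sum, hNsum]
      _ ≤ C₂ * (C₃ * ∑ j, (N.comp (γ ^ k)) (b j)) := by gcongr; exact h₃ _
      _ = _ := (mul_assoc _ _ _).symm
  · calc ∑ j, ∑ i, |((b.repr ((γ ^ k) (b j)) i : ℤ) : ℝ)| = ∑ j, (N.comp (γ ^ k)) (b j) := rfl
      _ ≤ C₄ * ∑ i, (N.comp L.mkQ) ((β ^ k) (g i)) := by rw [← hNsum]; exact h₄ _
      _ ≤ C₄ * ∑ i, C₁ * s ((β ^ k) (g i)) := by gcongr with i; exact h₁ _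
      _ = C₄ * (C₁ * ∑ y : ι × Fin (d + 1), (p.comp (β ^ k)) ((β ^ (y.2 : ℕ)) (g y.1))) := by
          rw [← Finset.mul_sum, Fintype.sum_prod_type]
          congr 2
          refine Finset.sum_congr rfl fun i _ => ?_
          rw [hsapp, Finset.sum_range]
          refine Finset.sum_congr rfl fun l _ => ?_
          rw [Seminorm.comp_apply, ← Module.End.mul_apply, ← Module.End.mul_apply, ← pow_add,
            ← pow_add, add_comm]
      _ ≤ C₄ * (C₁ * (C₅ * ∑ i, (p.comp (β ^ k)) (g i))) := by gcongr; exact h₅ _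
      _ = _ := by simp only [Seminorm.comp_apply]; ring

end Growth

/-! ### Heights of values of characters -/

variable {n : ℕ}

lemma character_add (a b : CharLattice n) (P : Torus n) :
    character (a + b) P = character a P * character b P := by
  simp [character, zpow_add, Finset.prod_mul_distrib]

lemma character_zsmul (c : ℤ) (a : CharLattice n) (P : Torus n) :
    character (c • a) P = character a P ^ c := by
  simp [character, ← Finset.prod_zpow, zpow_mul, mul_comm c]

lemma character_sub (a b : CharLattice n) (P : Torus n) :
    character (a - b) P = character a P / character b P := by
  rw [sub_eq_add_neg, ← neg_one_zsmul, character_add, character_zsmul, zpow_neg_one, div_eq_mul_inv]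

lemma character_pow (a : CharLattice n) (P : Torus n) (k : ℕ) :
    character a (P ^ k) = character a P ^ k := by
  simp only [character, Pi.pow_apply, ← Finset.prod_pow]
  exact Finset.prod_congr rfl fun j _ => by rw [← zpow_natCast, ← zpow_natCast, zpow_comm]

lemma zpow_finset_sum {G ι : Type*} [CommGroup G] (x : G) (s : Finset ι) (f : ι → ℤ) :
    x ^ ∑ i ∈ s, f i = ∏ i ∈ s, x ^ f i := by
  classical
  induction s using Finset.induction_on with
  | empty => simp
  | insert a s ha ih => rw [Finset.sum_insert ha, Finset.prod_insert ha, zpow_add, ih]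

lemma character_monomialMap (A : Matrix (Fin n) (Fin n) ℤ) (a : CharLattice n) (P : Torus n) :
    character a (monomialMap A P) = character (transposeAction A a) P := by
  have h : ∀ j, P j ^ (transposeAction A a) j = ∏ i, (P j ^ A i j) ^ a i := fun j => by
    simp only [Matrix.mulVecLin_apply, Matrix.mulVec, dotProduct, Matrix.transpose_apply]
    simp [zpow_finset_sum, zpow_mul]
  simp only [character, monomialMap] at h ⊢
  simp only [h, ← Finset.prod_zpow]
  exact Finset.prod_comm

lemma character_iterate (A : Matrix (Fin n) (Fin n) ℤ) (k : ℕ) (a : CharLattice n) (P : Torus n) :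
    character a ((monomialMap A)^[k] P) = character ((transposeAction A ^ k) a) P := by
  induction k generalizing P with
  | zero => rfl
  | succ k ih => rw [Function.iterate_succ_apply, ih, character_monomialMap, pow_succ',
      Module.End.mul_apply]

/-- The characters whose value at `Q` lies in the field `E`. -/
def fieldLattice (E : IntermediateField ℚ Qbar) (Q : Torus n) : Submodule ℤ (CharLattice n) where
  carrier := {a | (character a Q : Qbar) ∈ E}
  zero_mem' := by simp [character]
  add_mem' {a b} ha hb := by
    rw [Set.mem_ofPred_eq] at ha hb ⊢
    rw [character_add, Units.val_mul]
    exact mul_mem ha hb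
  smul_mem' c a ha := by
    rw [Set.mem_ofPred_eq] at ha ⊢
    rw [character_zsmul, Units.val_zpow_eq_zpow_val]
    exact zpow_mem ha c

/-- The value at `Q` of a character, in a field that contains it. -/
noncomputable def fieldCharacter (E : IntermediateField ℚ Qbar) (Q : Torus n) (a : fieldLattice E Q) : E :=
  ⟨(character a.1 Q : Qbar), a.2⟩

/-- The height, relative to the number field `E`, of the values at `Q` of characters. -/
noncomputable def heightSeminorm (E : IntermediateField ℚ Qbar) [NumberField E] (Q : Torus n) :
    Seminorm ℤ (fieldLattice E Q) :=
  Seminorm.of (fun a => Height.logHeight₁ (fieldCharacter E Q a))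
    (fun a b => by
      have h : fieldCharacter E Q (a + b) = fieldCharacter E Q a * fieldCharacter E Q b :=
        Subtype.ext (by simp [fieldCharacter, character_add])
      rw [h]
      exact Height.logHeight₁_mul_le _ _)
    (fun c a => by
      have h : fieldCharacter E Q (c • a) = fieldCharacter E Q a ^ c :=
        Subtype.ext (by
          change (character (c • a.1) Q : Qbar) = _
          rw [character_zsmul, Units.val_zpow_eq_zpow_val]
          exact (map_zpow₀ E.val (fieldCharacter E Q a) c).symm)
      rw [h, Height.logHeight₁_zpow, Int.norm_eq_abs, Nat.cast_natAbs, Int.cast_abs])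

lemma heightSeminorm_apply (E : IntermediateField ℚ Qbar) [NumberField E] (Q : Torus n)
    (a : fieldLattice E Q) :
    heightSeminorm E Q a = Height.logHeight₁ (fieldCharacter E Q a) := rfl

/-- Northcott's theorem gives a gap above height zero. -/
lemma isDiscrete_heightSeminorm (E : IntermediateField ℚ Qbar) [NumberField E] (Q : Torus n) :
    IsDiscrete (heightSeminorm E Q) := by
  have hfin := (NumberField.finite_setOfPred_logHeight₁_le (K := E) 1).image Height.logHeight₁
  have hfin' := hfin.subset (Set.sep_subset _ fun x => 0 < x)
  obtain ⟨δ, hδ, h⟩ : ∃ δ : ℝ, 0 < δ ∧ ∀ x ∈ hfin'.toFinset, δ ≤ x := by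
    by_cases hne : hfin'.toFinset.Nonempty
    · exact ⟨hfin'.toFinset.min' hne, ((hfin'.mem_toFinset).1 (Finset.min'_mem _ hne)).2,
        fun x hx => Finset.min'_le _ _ hx⟩
    · rw [Finset.not_nonempty_iff_eq_empty] at hne
      exact ⟨1, one_pos, fun x hx => absurd hx (by rw [hne]; exact Finset.notMem_empty x)⟩
  refine ⟨min δ 1, lt_min hδ one_pos, fun a ha => ?_⟩
  have h0 : 0 < heightSeminorm E Q a := lt_of_le_of_ne (apply_nonneg _ _) ha.symm
  by_cases h1 : heightSeminorm E Q a ≤ 1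
  · refine (min_le_left _ _).trans (h _ ((hfin'.mem_toFinset).2 ⟨⟨_, h1, rfl⟩, h0⟩))
  · exact (min_le_right _ _).trans (not_le.1 h1).le

/-- Kronecker's theorem: height zero characterises roots of unity. -/
lemma heightSeminorm_eq_zero_iff (E : IntermediateField ℚ Qbar) [NumberField E] (Q : Torus n)
    (a : fieldLattice E Q) :
    heightSeminorm E Q a = 0 ↔ ∃ k : ℕ, 1 ≤ k ∧ character a.1 Q ^ k = 1 := by
  constructor
  · intro h
    -- All powers have height zero, so two of them coincide.
    have hfin := NumberField.finite_setOfPred_logHeight₁_le (K := E) 0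
    obtain ⟨i, j, hij, heq⟩ := Set.Finite.exists_lt_map_eq_of_forall_mem
      (f := fun k : ℕ => fieldCharacter E Q a ^ k) (t := {x : E | Height.logHeight₁ x ≤ 0})
      (fun k => by
        rw [heightSeminorm_apply] at h
        rw [Set.mem_ofPred_eq, Height.logHeight₁_pow, h, mul_zero]) hfin
    refine ⟨j - i, by omega, ?_⟩
    have h2 : character a.1 Q ^ i = character a.1 Q ^ j := by
      ext
      simpa [fieldCharacter] using congrArg Subtype.val heq
    rw [pow_sub _ hij.le, h2, mul_inv_cancel]
  · rintro ⟨k, hk, hk1⟩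
    have h1 : fieldCharacter E Q a ^ k = 1 := by
      apply Subtype.ext
      simpa [fieldCharacter] using congrArg Units.val hk1
    have h2 := Height.logHeight₁_pow (fieldCharacter E Q a) k
    rw [h1, Height.logHeight₁_one] at h2
    have hk0 : (k : ℝ) ≠ 0 := by exact_mod_cast (by omega : k ≠ 0)
    exact (mul_eq_zero.1 h2.symm).resolve_left hk0

/-- The field of definition of a point of the torus. -/
noncomputable abbrev pointField (Q : Torus n) : IntermediateField ℚ Qbar :=
  coordField fun i => (Q i : Qbar)

lemma character_mem_pointField (Q : Torus n) (a : CharLattice n) :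
    (character a Q : Qbar) ∈ pointField Q := by
  simp only [character, Units.coe_prod, Units.val_zpow_eq_zpow_val]
  exact prod_mem fun j _ => zpow_mem (IntermediateField.subset_adjoin ℚ _ (Set.mem_range_self j)) _

/-- The seminorm on the character lattice given by the heights of the values at `Q`, relative to
the field of definition of `Q`. -/
noncomputable def charHeight (Q : Torus n) : Seminorm ℤ (CharLattice n) :=
  (heightSeminorm (pointField Q) Q).comp
    (LinearMap.codRestrict (fieldLattice (pointField Q) Q) LinearMap.id (character_mem_pointField Q))

lemma isDiscrete_charHeight (Q : Torus n) : IsDiscrete (charHeight Q) :=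
  (isDiscrete_heightSeminorm _ Q).comp _

lemma charHeight_eq_zero_iff (Q : Torus n) (a : CharLattice n) :
    charHeight Q a = 0 ↔ ∃ k : ℕ, 1 ≤ k ∧ character a Q ^ k = 1 :=
  heightSeminorm_eq_zero_iff (pointField Q) Q _

/-- Heights relative to different number fields are comparable on the values of characters at `Q`:
both are discrete, with kernel the characters that are torsion at `Q`. -/
lemma exists_charHeight_le_heightSeminorm (E : IntermediateField ℚ Qbar) [NumberField E]
    (Q : Torus n) :
    ∃ C : ℝ, 0 ≤ C ∧ ∀ a : fieldLattice E Q,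
      charHeight Q a ≤ C * heightSeminorm E Q a ∧ heightSeminorm E Q a ≤ C * charHeight Q a := by
  have hd := (isDiscrete_charHeight Q).comp (fieldLattice E Q).subtype
  have h0 : ∀ a : fieldLattice E Q,
      ((charHeight Q).comp (fieldLattice E Q).subtype) a = 0 ↔ heightSeminorm E Q a = 0 :=
    fun a => (charHeight_eq_zero_iff Q a).trans (heightSeminorm_eq_zero_iff E Q a).symm
  obtain ⟨C₁, hC₁, h₁⟩ := exists_seminorm_le_of_isDiscrete _ _ (isDiscrete_heightSeminorm E Q)
    fun a => (h0 a).2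
  obtain ⟨C₂, hC₂, h₂⟩ := exists_seminorm_le_of_isDiscrete _ _ hd fun a => (h0 a).1
  refine ⟨max C₁ C₂, hC₁.trans (le_max_left _ _), fun a => ⟨(h₁ a).trans ?_, (h₂ a).trans ?_⟩⟩
  · exact mul_le_mul_of_nonneg_right (le_max_left _ _) (apply_nonneg _ _)
  · exact mul_le_mul_of_nonneg_right (le_max_right _ _) (apply_nonneg _ _)

/-! ### Heights of tuples -/

section TupleHeight

variable {K : Type*} [Field K] [Height.AdmissibleAbsValues K] {ι : Type*}

/-- The height of a point of projective space is at least that of a ratio of its coordinates. -/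
lemma logHeight₁_div_le_logHeight [Finite ι] (x : ι → K) (i j : ι) :
    Height.logHeight₁ (x i / x j) ≤ Height.logHeight x := by
  rw [Height.logHeight₁_div_eq_logHeight]
  have : ![x i, x j] = x ∘ ![i, j] := by
    funext l; fin_cases l <;> rfl
  rw [this]
  exact Height.logHeight_comp_le _ _

/-- The tuple `x` is part of the multiplication table of the pairs `(x i, 1)`. -/
lemma logHeight_le_sum_logHeight₁ [Fintype ι] (x : ι → K) :
    Height.logHeight x ≤ ∑ i, Height.logHeight₁ (x i) := by
  classical
  have hne : ∀ i, (![x i, 1] : Fin 2 → K) ≠ 0 := fun i h => by simpa using congrFun h 1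
  have h := Height.logHeight_fun_prod_eq (x := fun i => (![x i, 1] : Fin 2 → K)) hne
  have hx : x = (fun I : ι → Fin 2 => ∏ i, (![x i, 1] : Fin 2 → K) (I i)) ∘
      fun j i => if i = j then 0 else 1 := by
    funext j
    simp only [Function.comp_apply]
    rw [Finset.prod_eq_single j]
    · simp
    · intro i _ hij; simp [hij]
    · intro hj; exact absurd (Finset.mem_univ j) hj
  calc Height.logHeight x ≤
        Height.logHeight (fun I : ι → Fin 2 => ∏ i, (![x i, 1] : Fin 2 → K) (I i)) := by
        conv_lhs => rw [hx]
        exact Height.logHeight_comp_le _ _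
    _ = _ := by
        rw [h]
        exact Finset.sum_congr rfl fun i _ => (Height.logHeight₁_eq_logHeight _).symm

lemma logHeight_le_sum_logHeight₁_div [Fintype ι] (x : ι → K) {j : ι} (hj : x j ≠ 0) :
    Height.logHeight x ≤ ∑ i, Height.logHeight₁ (x i / x j) := by
  rw [← Height.logHeight_smul_eq_logHeight x (inv_ne_zero hj)]
  refine (logHeight_le_sum_logHeight₁ _).trans_eq (Finset.sum_congr rfl fun i _ => ?_)
  rw [Pi.smul_apply, smul_eq_mul, div_eq_inv_mul]

end TupleHeight

lemma absLogHeight_eq_of_coordField_eq {ι : Type*} [Finite ι] {x : ι → Qbar}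
    {E : IntermediateField ℚ Qbar} [NumberField E] (h : coordField x = E) (hx : ∀ i, x i ∈ E) :
    absLogHeight x = Height.logHeight (fun i => (⟨x i, hx i⟩ : E)) / Module.finrank ℚ E := by
  subst h
  rfl

/-! ### Comparison of the height of a tuple with the heights of its ratios -/

/-- The height of the tuple of characters `u a` with `a ∈ S` at `Q` is, for all `u` for which this
tuple generates the field `E`, comparable to the sum of the heights of the differences. -/
lemma exists_absLogHeight_comparable (S : Finset (CharLattice n)) (hS : S.Nonempty)
    (E : IntermediateField ℚ Qbar) [NumberField E] (Q : Torus n) :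
    ∃ C : ℝ, 0 ≤ C ∧ ∀ u : Module.End ℤ (CharLattice n),
      coordField (fun a : S => (character (u a.1) Q : Qbar)) = E →
      absLogHeight (fun a : S => (character (u a.1) Q : Qbar)) ≤
          C * ∑ y : S × S, charHeight Q (u (y.1 - y.2)) ∧
        ∑ y : S × S, charHeight Q (u (y.1 - y.2)) ≤
          C * absLogHeight (fun a : S => (character (u a.1) Q : Qbar)) := by
  obtain ⟨C, hC, hCE⟩ := exists_charHeight_le_heightSeminorm E Q
  obtain ⟨a₀⟩ : Nonempty S := hS.to_subtype
  have hd : (1 : ℝ) ≤ Module.finrank ℚ E := by exact_mod_cast Module.finrank_pos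
  set d : ℝ := (Module.finrank ℚ E : ℝ)
  refine ⟨max C (Fintype.card (S × S) * (C * d)), hC.trans (le_max_left _ _), fun u hu => ?_⟩
  have hmem : ∀ a : S, (character (u a.1) Q : Qbar) ∈ E := fun a => by
    rw [← hu]; exact IntermediateField.subset_adjoin ℚ _ (Set.mem_range_self a)
  rw [absLogHeight_eq_of_coordField_eq hu hmem]
  set x : S → E := fun a => ⟨(character (u a.1) Q : Qbar), hmem a⟩ with hx
  have hsub : ∀ a b : S, u (a - b) ∈ fieldLattice E Q := fun a b => by
    rw [map_sub]
    exact Submodule.sub_mem _ (hmem a) (hmem b)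
  have hdiv : ∀ a b : S,
      Height.logHeight₁ (x a / x b) = heightSeminorm E Q ⟨u (a - b), hsub a b⟩ := fun a b => by
    rw [heightSeminorm_apply]
    congr 1
    apply Subtype.ext
    simp [fieldCharacter, hx, map_sub, character_sub]
  have hsum0 : 0 ≤ ∑ y : S × S, charHeight Q (u (y.1 - y.2)) :=
    Finset.sum_nonneg fun _ _ => apply_nonneg _ _
  have hx0 : 0 ≤ Height.logHeight x := Height.logHeight_nonneg x
  constructor
  · calc Height.logHeight x / d ≤ Height.logHeight x := div_le_self hx0 hd
      _ ≤ ∑ a : S, Height.logHeight₁ (x a / x a₀) :=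
          logHeight_le_sum_logHeight₁_div x (j := a₀) fun h =>
            (character (u a₀.1) Q).ne_zero (congrArg Subtype.val h)
      _ ≤ ∑ a : S, C * charHeight Q (u (a - a₀)) := Finset.sum_le_sum fun a _ => by
          rw [hdiv]; exact (hCE _).2
      _ = C * ∑ a : S, charHeight Q (u (a - a₀)) := (Finset.mul_sum _ _ _).symm
      _ ≤ C * ∑ y : S × S, charHeight Q (u (y.1 - y.2)) := by
          gcongr
          rw [Fintype.sum_prod_type]
          refine Finset.sum_le_sum fun a _ => ?_
          exact Finset.single_le_sum (f := fun b : S => charHeight Q (u (a - b)))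
            (fun _ _ => apply_nonneg _ _) (Finset.mem_univ a₀)
      _ ≤ _ := mul_le_mul_of_nonneg_right (le_max_left _ _) hsum0
  · calc ∑ y : S × S, charHeight Q (u (y.1 - y.2)) ≤ ∑ y : S × S, C * Height.logHeight x := by
          refine Finset.sum_le_sum fun y _ => ((hCE ⟨_, hsub y.1 y.2⟩).1).trans ?_
          rw [← hdiv]
          exact mul_le_mul_of_nonneg_left (logHeight₁_div_le_logHeight x _ _) hC
      _ = (Fintype.card (S × S) * (C * d)) * (Height.logHeight x / d) := by
          rw [Finset.sum_const, nsmul_eq_mul, Finset.card_univ]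
          field_simp
      _ ≤ _ := mul_le_mul_of_nonneg_right (le_max_right _ _) (by positivity)

/-- A number field has only finitely many subfields. -/
lemma finite_setOf_le_intermediateField (K : IntermediateField ℚ Qbar) [NumberField K] :
    {E : IntermediateField ℚ Qbar | E ≤ K}.Finite := by
  have hfd : @FiniteDimensional ℚ K _ _ K.algebra'.toModule := by
    convert (inferInstance : FiniteDimensional ℚ K)
  have : Finite (@IntermediateField ℚ K _ _ K.algebra') :=
    @Field.finite_intermediateField_of_exists_primitive_element ℚ K _ _ K.algebra'
      inferInstance (@Field.exists_primitive_element ℚ K _ _ K.algebra' hfd inferInstance)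
  refine (Set.finite_range (IntermediateField.lift (F := K))).subset fun E hE => ?_
  exact ⟨IntermediateField.restrict hE, IntermediateField.lift_restrict hE⟩

/-- The constant in `exists_absLogHeight_comparable` can be chosen for all `u` at once:
the field generated by the tuple is one of the finitely many subfields of the field of definition
of `Q`. -/
lemma exists_absLogHeight_comparable_uniform (S : Finset (CharLattice n)) (hS : S.Nonempty)
    (Q : Torus n) :
    ∃ C : ℝ, 0 ≤ C ∧ ∀ u : Module.End ℤ (CharLattice n),
      absLogHeight (fun a : S => (character (u a.1) Q : Qbar)) ≤
          C * ∑ y : S × S, charHeight Q (u (y.1 - y.2)) ∧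
        ∑ y : S × S, charHeight Q (u (y.1 - y.2)) ≤
          C * absLogHeight (fun a : S => (character (u a.1) Q : Qbar)) := by
  have hsub : ∀ u : Module.End ℤ (CharLattice n),
      coordField (fun a : S => (character (u a.1) Q : Qbar)) ≤ pointField Q := fun u => by
    rw [IntermediateField.adjoin_le_iff]
    rintro _ ⟨a, rfl⟩
    exact character_mem_pointField Q _
  have key : ∀ E : IntermediateField ℚ Qbar, ∃ C : ℝ, 0 ≤ C ∧
      ∀ u : Module.End ℤ (CharLattice n),
      coordField (fun a : S => (character (u a.1) Q : Qbar)) = E →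
      absLogHeight (fun a : S => (character (u a.1) Q : Qbar)) ≤
          C * ∑ y : S × S, charHeight Q (u (y.1 - y.2)) ∧
        ∑ y : S × S, charHeight Q (u (y.1 - y.2)) ≤
          C * absLogHeight (fun a : S => (character (u a.1) Q : Qbar)) := fun E => by
    by_cases hE : ∃ u : Module.End ℤ (CharLattice n),
        coordField (fun a : S => (character (u a.1) Q : Qbar)) = E
    · obtain ⟨u, rfl⟩ := hE
      exact exists_absLogHeight_comparable S hS _ Q
    · exact ⟨0, le_rfl, fun u hu => (hE ⟨u, hu⟩).elim⟩
  choose C hC hCE using key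
  have hfin := finite_setOf_le_intermediateField (pointField Q)
  refine ⟨∑ E ∈ hfin.toFinset, C E, Finset.sum_nonneg fun E _ => hC E, fun u => ?_⟩
  have hle : C (coordField fun a : S => (character (u a.1) Q : Qbar)) ≤
      ∑ E ∈ hfin.toFinset, C E :=
    Finset.single_le_sum (fun E _ => hC E) (hfin.mem_toFinset.2 (hsub u))
  obtain ⟨h₁, h₂⟩ := hCE _ u rfl
  refine ⟨h₁.trans (mul_le_mul_of_nonneg_right hle
    (Finset.sum_nonneg fun _ _ => apply_nonneg _ _)), h₂.trans (mul_le_mul_of_nonneg_right hle ?_)⟩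
  exact div_nonneg (Height.logHeight_nonneg _) (Nat.cast_nonneg _)

/-! ### Lattices and arithmetic degrees -/

/-- An integer vector in the real span of a lattice has a multiple in the lattice. A `ℚ`-linear
retraction `ℝ → ℚ` turns real coefficients into rational ones. -/
lemma exists_nsmul_mem_of_mem_span_real {L : Submodule ℤ (CharLattice n)} {m : CharLattice n}
    (hm : (fun i => (m i : ℝ)) ∈
      Submodule.span ℝ ((fun (a : CharLattice n) (i : Fin n) => (a i : ℝ)) '' (L : Set _))) :
    ∃ q : ℕ, 1 ≤ q ∧ q • m ∈ L := by
  obtain ⟨π, hπ⟩ := LinearMap.exists_leftInverse_of_injective (Algebra.linearMap ℚ ℝ)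
    (LinearMap.ker_eq_bot.2 (algebraMap ℚ ℝ).injective)
  have hπz : ∀ (r : ℝ) (c : ℤ), π (r * c) = π r * c := fun r c => by
    rw [mul_comm, ← zsmul_eq_mul, map_zsmul, zsmul_eq_mul, mul_comm]
  have key : ∀ v ∈ Submodule.span ℝ
      ((fun (a : CharLattice n) (i : Fin n) => (a i : ℝ)) '' (L : Set _)),
      ∀ r : ℝ, ∃ q : ℕ, 1 ≤ q ∧ ∃ l ∈ L, ∀ i, (q : ℚ) * π (r * v i) = (l i : ℚ) := by
    intro v hv
    refine Submodule.span_induction ?_ ?_ ?_ ?_ hv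
    · rintro _ ⟨l, hl, rfl⟩ r
      refine ⟨(π r).den, (π r).pos, (π r).num • l, L.smul_mem _ hl, fun i => ?_⟩
      rw [hπz, ← mul_assoc, Rat.den_mul_eq_num]
      simp
    · exact fun r => ⟨1, le_rfl, 0, L.zero_mem, fun i => by simp⟩
    · intro x y _ _ hx hy r
      obtain ⟨q, hq, l, hl, h⟩ := hx r
      obtain ⟨q', hq', l', hl', h'⟩ := hy r
      refine ⟨q * q', Nat.mul_pos hq hq', (q' : ℤ) • l + (q : ℤ) • l',
        L.add_mem (L.smul_mem _ hl) (L.smul_mem _ hl'), fun i => ?_⟩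
      simp only [Pi.add_apply, Pi.smul_apply, smul_eq_mul, mul_add, map_add]
      push_cast
      rw [← h, ← h']
      ring
    · intro s x _ hx r
      obtain ⟨q, hq, l, hl, h⟩ := hx (r * s)
      exact ⟨q, hq, l, hl, fun i => by rw [← h, Pi.smul_apply, smul_eq_mul, mul_assoc]⟩
  obtain ⟨q, hq, l, hl, h⟩ := key _ hm 1
  refine ⟨q, hq, ?_⟩
  have hl' : q • m = l := by
    funext i
    have h1 := h i
    rw [hπz, show π 1 = 1 from by simpa using LinearMap.congr_fun hπ 1, one_mul] at h1
    rw [Pi.smul_apply, nsmul_eq_mul]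
    exact_mod_cast h1
  rwa [hl']

lemma IsFullDimensional.exists_nsmul_mem_span {S : Finset (CharLattice n)}
    (hS : IsFullDimensional S) (m : CharLattice n) :
    ∃ q : ℕ, 1 ≤ q ∧
      q • m ∈ Submodule.span ℤ (Set.range fun y : S × S => (y.1 - y.2 : CharLattice n)) := by
  refine exists_nsmul_mem_of_mem_span_real ?_
  have hle : Submodule.span ℝ {v : Fin n → ℝ |
      ∃ a ∈ S, ∃ b ∈ S, v = fun i => ((a i - b i : ℤ) : ℝ)} ≤
      Submodule.span ℝ ((fun (a : CharLattice n) (i : Fin n) => (a i : ℝ)) ''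
        (Submodule.span ℤ (Set.range fun y : S × S => (y.1 - y.2 : CharLattice n)) : Set _)) := by
    refine Submodule.span_mono ?_
    rintro _ ⟨a, ha, b, hb, rfl⟩
    exact ⟨a - b, Submodule.subset_span ⟨(⟨a, ha⟩, ⟨b, hb⟩), rfl⟩, rfl⟩
  rw [hS.2] at hle
  exact hle trivial

/-- The largest invariant lattice whose characters are all torsion at `Q`. -/
noncomputable def torsionLattice (A : Matrix (Fin n) (Fin n) ℤ) (Q : Torus n) :
    invariantLattices A :=
  ⟨invariantKernel (transposeAction A) (charHeight Q), fun m =>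
    ⟨fun hm => Submodule.subset_span ⟨m, hm, rfl⟩, fun hm => by
      obtain ⟨q, hq, h⟩ := exists_nsmul_mem_of_mem_span_real hm
      refine mem_invariantKernel_of_zsmul_mem (q := q) (by exact_mod_cast (by omega : q ≠ 0)) ?_
      rwa [natCast_zsmul]⟩, invariantKernel_le_comap _ _⟩

lemma mem_divisibleHull_subgroupOfLattice {L : Submodule ℤ (CharLattice n)} {Q : Torus n} :
    Q ∈ divisibleHull (subgroupOfLattice L) ↔ ∀ a ∈ L, charHeight Q a = 0 := by
  constructor
  · rintro ⟨k, hk, h⟩ a ha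
    exact (charHeight_eq_zero_iff Q a).2 ⟨k, hk, by rw [← character_pow]; exact h a ha⟩
  · intro h
    obtain ⟨s, hs⟩ := (inferInstance : IsNoetherian ℤ (CharLattice n)).noetherian L
    have hmem : ∀ a : s, ∃ k : ℕ, 1 ≤ k ∧ character a.1 Q ^ k = 1 := fun a =>
      (charHeight_eq_zero_iff Q a.1).1 (h a.1 (hs ▸ Submodule.subset_span a.2))
    choose k hk hk1 using hmem
    refine ⟨∏ a, k a, Nat.succ_le_of_lt (Finset.prod_pos fun a _ => hk a), fun a ha => ?_⟩
    rw [← hs] at ha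
    refine Submodule.span_induction (p := fun a _ => character a (Q ^ ∏ a, k a) = 1)
      ?_ ?_ ?_ ?_ ha
    · intro x hx
      obtain ⟨c, hc⟩ := Finset.dvd_prod_of_mem k (Finset.mem_univ (⟨x, hx⟩ : s))
      rw [character_pow, hc, pow_mul, hk1 ⟨x, hx⟩, one_pow]
    · simp [character]
    · intro x y _ _ hx hy
      rw [character_add, hx, hy, one_mul]
    · intro c x _ hx
      rw [character_zsmul, hx, one_zpow]

lemma mem_divisibleHull_torsionLattice (A : Matrix (Fin n) (Fin n) ℤ) (Q : Torus n) :
    Q ∈ divisibleHull (subgroupOfLattice (torsionLattice A Q).1) :=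
  mem_divisibleHull_subgroupOfLattice.2 fun _ ha => mem_invariantKernel.1 ha 0

lemma le_torsionLattice {A : Matrix (Fin n) (Fin n) ℤ} {Q : Torus n} (L : invariantLattices A)
    (hQ : Q ∈ divisibleHull (subgroupOfLattice L.1)) : L.1 ≤ (torsionLattice A Q).1 := by
  intro a ha
  refine mem_invariantKernel.2 fun k => mem_divisibleHull_subgroupOfLattice.1 hQ _ ?_
  induction k with
  | zero => exact ha
  | succ k ih =>
    rw [pow_succ', Module.End.mul_apply]
    exact L.2.2 ih

lemma latticeRadius_antitone {A : Matrix (Fin n) (Fin n) ℤ} {L L' : invariantLattices A}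
    (h : L.1 ≤ L'.1) : latticeRadius L' ≤ latticeRadius L := by
  refine biSup_mono fun z hz => ?_
  refine spectrum_baseChange_subset_of_surjective (π := Submodule.factor h)
    (Submodule.factor_surjective h) ?_ hz
  refine Submodule.linearMap_qext _ ?_
  ext
  rfl

lemma latticeRadius_lt_top {A : Matrix (Fin n) (Fin n) ℤ} (L : invariantLattices A) :
    latticeRadius L < ⊤ :=
  spectralRadius_baseChange_lt_top _

/-- Each radius is computed from a subset of the finite set of eigenvalues of the matrix. -/
lemma finite_range_latticeRadius (A : Matrix (Fin n) (Fin n) ℤ) :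
    (Set.range (latticeRadius (A := A))).Finite := by
  have hfin := Module.End.finite_spectrum
    (LinearMap.baseChange ℂ (transposeAction A) :
      Module.End ℂ (TensorProduct ℤ ℂ (CharLattice n)))
  refine (hfin.finite_subsets.image
    fun s => (⨆ z ∈ s, (‖z‖₊ : ENNReal))).subset ?_
  rintro _ ⟨L, rfl⟩
  refine ⟨spectrum ℂ (LinearMap.baseChange ℂ (quotientMap L) :
    Module.End ℂ (TensorProduct ℤ ℂ (CharLattice n ⧸ L.1))), ?_, rfl⟩
  exact spectrum_baseChange_subset_of_surjective (π := L.1.mkQ) L.1.mkQ_surjective (by ext; rfl)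

lemma torusHeight_iterate (S : Finset (CharLattice n)) (A : Matrix (Fin n) (Fin n) ℤ)
    (Q : Torus n) (k : ℕ) :
    torusHeight S ((monomialMap A)^[k] Q) =
      absLogHeight fun a : S => (character ((transposeAction A ^ k) a.1) Q : Qbar) := by
  simp only [torusHeight, character_iterate]

/-- The arithmetic degree is the spectral radius on the quotient by the torsion lattice, or `1` if
that is larger. -/
theorem tendsto_degreeSeq {S : Finset (CharLattice n)} (hS : IsFullDimensional S)
    (A : Matrix (Fin n) (Fin n) ℤ) (Q : Torus n) :
    Tendsto (degreeSeq S A Q) atTop (𝓝 (max (latticeRadius (torsionLattice A Q)).toReal 1)) := by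
  have hgrow := tendsto_sum_seminorm_pow (transposeAction A) (isDiscrete_charHeight Q)
    (Pi.basisFun ℤ (Fin n)).span_eq
  obtain ⟨C, hC, hCS⟩ := exists_absLogHeight_comparable_uniform S hS.1 Q
  obtain ⟨C₁, hC₁, h₁⟩ := exists_sum_seminorm_le_of_mem_span (g := Pi.basisFun ℤ (Fin n))
    (x := fun y : S × S => (y.1 - y.2 : CharLattice n))
    fun j => ⟨1, le_rfl, by rw [(Pi.basisFun ℤ (Fin n)).span_eq]; trivial⟩
  obtain ⟨C₂, hC₂, h₂⟩ := exists_sum_seminorm_le_of_mem_span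
    (g := fun y : S × S => (y.1 - y.2 : CharLattice n)) (x := Pi.basisFun ℤ (Fin n))
    fun j => hS.exists_nsmul_mem_span _
  have h0 : ∀ k, 0 ≤ torusHeight S ((monomialMap A)^[k] Q) := fun k =>
    div_nonneg (Height.logHeight_nonneg _) (Nat.cast_nonneg _)
  have hlim : Tendsto (fun k : ℕ => torusHeight S ((monomialMap A)^[k] Q) ^ (1 / (k : ℝ))) atTop
      (𝓝 (latticeRadius (torsionLattice A Q)).toReal) := by
    refine tendsto_rpow_one_div_of_le (C₁ := C * C₁) (C₂ := C₂ * C)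
      (fun k => Finset.sum_nonneg fun i _ => apply_nonneg _ _) h0 (fun k => ?_) (fun k => ?_) hgrow
    · rw [torusHeight_iterate, mul_assoc]
      refine (hCS _).1.trans (mul_le_mul_of_nonneg_left ?_ hC)
      exact h₁ ((charHeight Q).comp (transposeAction A ^ k))
    · rw [torusHeight_iterate, mul_assoc]
      refine (h₂ ((charHeight Q).comp (transposeAction A ^ k))).trans
        (mul_le_mul_of_nonneg_left ?_ hC₂)
      exact (hCS _).2
  refine (hlim.max tendsto_const_nhds).congr fun k => ?_
  -- `x ↦ x ^ (1 / k)` is monotone on `x ≥ 0` only, hence the truncation `max x 0`.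
  have hmono : Monotone fun x : ℝ => (max x 0) ^ (1 / (k : ℝ)) := fun x y hxy =>
    Real.rpow_le_rpow (le_max_right _ _) (max_le_max_right _ hxy) (by positivity)
  have := hmono.map_max (a := torusHeight S ((monomialMap A)^[k] Q)) (b := 1)
  rw [max_eq_left (h0 k), max_eq_left zero_le_one, Real.one_rpow,
    max_eq_left (zero_le_one.trans (le_max_right _ _))] at this
  exact this.symm

lemma arithDegree_eq {S : Finset (CharLattice n)} (hS : IsFullDimensional S)
    (A : Matrix (Fin n) (Fin n) ℤ) (Q : Torus n) :
    arithDegree S A Q = max (latticeRadius (torsionLattice A Q)).toReal 1 :=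
  (tendsto_degreeSeq hS A Q).limUnder_eq

lemma arithDegree_one {S : Finset (CharLattice n)} (hS : IsFullDimensional S)
    (A : Matrix (Fin n) (Fin n) ℤ) : arithDegree S A 1 = 1 := by
  have htop : (torsionLattice A (1 : Torus n)).1 = ⊤ := by
    refine eq_top_iff.2 fun a _ => mem_invariantKernel.2 fun k => ?_
    exact (charHeight_eq_zero_iff _ _).2 ⟨1, le_rfl, by simp [character]⟩
  have hsub : Subsingleton (CharLattice n ⧸ (torsionLattice A (1 : Torus n)).1) :=
    Submodule.Quotient.subsingleton_iff.2 htop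
  have : Subsingleton (TensorProduct ℤ ℂ (CharLattice n ⧸ (torsionLattice A (1 : Torus n)).1)) :=
    inferInstance
  have hr : latticeRadius (torsionLattice A (1 : Torus n)) = 0 := by
    rw [latticeRadius, Subsingleton.elim (LinearMap.baseChange ℂ _) 0]
    exact spectrum.SpectralRadius.of_subsingleton _
  rw [arithDegree_eq hS, hr]
  simp

lemma finite_range_arithDegree {S : Finset (CharLattice n)} (hS : IsFullDimensional S)
    (A : Matrix (Fin n) (Fin n) ℤ) : (Set.range (arithDegree S A)).Finite := by
  refine ((finite_range_latticeRadius A).image fun r => max r.toReal 1).subset ?_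
  rintro _ ⟨Q, rfl⟩
  exact ⟨_, ⟨torsionLattice A Q, rfl⟩, (arithDegree_eq hS A Q).symm⟩

lemma arithDegree_le_iff {S : Finset (CharLattice n)} (hS : IsFullDimensional S)
    (A : Matrix (Fin n) (Fin n) ℤ) (Q : Torus n) {ρ : ℝ} (hρ : 1 ≤ ρ) :
    arithDegree S A Q ≤ ρ ↔ ∃ L : invariantLattices A, latticeRadius L ≤ ENNReal.ofReal ρ ∧
      Q ∈ divisibleHull (subgroupOfLattice L.1) := by
  rw [arithDegree_eq hS, max_le_iff, and_iff_left hρ,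
    ← ENNReal.le_ofReal_iff_toReal_le (latticeRadius_lt_top _).ne (zero_le_one.trans hρ)]
  exact ⟨fun h => ⟨_, h, mem_divisibleHull_torsionLattice A Q⟩,
    fun ⟨L, hL, hQ⟩ => (latticeRadius_antitone (le_torsionLattice L hQ)).trans hL⟩

end MonomialDynamics

theorem mainTheorem5 (n : ℕ) (S : Finset (MonomialDynamics.CharLattice n))
    (hS : MonomialDynamics.IsFullDimensional S) (A : Matrix (Fin n) (Fin n) ℤ) :
    (∀ Q : MonomialDynamics.Torus n, ∃ a : ℝ,
      Filter.Tendsto (MonomialDynamics.degreeSeq S A Q) Filter.atTop (nhds a)) ∧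
    ∃ (s : ℕ) (ρ : Fin (s + 1) → ℝ),
      StrictMono ρ ∧ ρ 0 = 1 ∧
      Set.range ρ = Set.range (MonomialDynamics.arithDegree S A) ∧
      ∀ j : Fin (s + 1),
        {Q : MonomialDynamics.Torus n | MonomialDynamics.arithDegree S A Q ≤ ρ j} =
          ⋃ (L : MonomialDynamics.invariantLattices A)
            (_ : MonomialDynamics.latticeRadius L ≤ ENNReal.ofReal (ρ j)),
            MonomialDynamics.divisibleHull (MonomialDynamics.subgroupOfLattice L.1) := by
  open MonomialDynamics in
  refine ⟨fun Q => ⟨_, tendsto_degreeSeq hS A Q⟩, ?_⟩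
  have hfin := finite_range_arithDegree hS A
  set D := hfin.toFinset with hD
  have h1D : (1 : ℝ) ∈ D := hfin.mem_toFinset.2 ⟨1, arithDegree_one hS A⟩
  have hle : ∀ x ∈ D, 1 ≤ x := fun x hx => by
    obtain ⟨Q, rfl⟩ := hfin.mem_toFinset.1 hx
    rw [arithDegree_eq hS]
    exact le_max_right _ _
  obtain ⟨s, hs⟩ := Nat.exists_eq_succ_of_ne_zero (Finset.card_ne_zero_of_mem h1D)
  refine ⟨s, D.orderEmbOfFin hs, (D.orderEmbOfFin hs).strictMono, ?_, ?_, fun j => ?_⟩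
  · refine (Finset.orderEmbOfFin_zero hs (Nat.succ_pos s)).trans ?_
    exact le_antisymm (Finset.min'_le _ _ h1D) (hle _ (Finset.min'_mem _ _))
  · rw [Finset.range_orderEmbOfFin, hD, hfin.coe_toFinset]
  · ext Q
    simp only [Set.mem_ofPred_eq, Set.mem_iUnion, exists_prop]
    exact arithDegree_le_iff hS A Q (hle _ (Finset.orderEmbOfFin_mem _ _ _))
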